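/- Let $p$ be a prime, $N\ge 1$ an integer, $\mathcal A_N=\{1,\dots,N\}$, and let $w=a_1a_2a_3\ldots\in\mathcal A_N^{\mathbb N}$ be an infinite word; let $w_n=a_1\ldots a_n$ be its prefix of length $n$ and $\mathrm T w=a_2a_3\ldots$ the shift. For a letter $a$ put $A_a=\begin{pmatrix}0&1\\1&a\end{pmatrix}$, and for a finite word $u=u_1\ldots u_n$ put $A_u=A_{u_1}\cdots A_{u_n}$ (the identity for the empty word). On pairs $(w,\mathbf x_p)$ with $\mathbf x_p\in\mathbf P^1_{\mathbb Q_p}$ let $\mathrm T(w,\mathbf x_p)=(\mathrm Tw,A_{a_1}\mathbf x_p)$. For $\epsilon>0$ let $\mathbf{PBad}_\epsilon$ be the set of all $(q_1:q_2)\in\mathbf P^1_{\mathbb Q_p}$ such that $$|aq_1+bq_2|_p\cdot\min\{|q_1|_p^{-1},|q_2|_p^{-1}\}\ \ge\ \epsilon\cdot\min\{|a|^{-2},|b|^{-2}\}\qquad\text{for all }(a,b)\in\mathbb Z^2\setminus\{(0,0)\}$$ (with $0^{-1}=\infty$), and let $\mathbf{LMad}$ be the set of pairs $(w,\mathbf x_p)$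 for which there is an $\epsilon>0$ such that $\mathrm T^n(w,\mathbf x_p)\in\mathcal A_M^{\mathbb N}\times\mathbf{PBad}_\epsilon$ for every $n\ge 1$, where $M=[\epsilon^{-1}]+1$. Let $\mathrm{SL}_2^{\pm}(\mathbb Z_p)$ be the set of $2\times2$ matrices over $\mathbb Z_p$ with determinant $\pm1$. For $A\in\mathrm{SL}_2^{\pm}(\mathbb Z_p)$ with two different eigenvectors in $\mathbf P^1_{\overline{\mathbb Q}_p}$ let $\kappa(A)$ be the least positive integer $k\le p^2$ such that $|\lambda^{k}-1|_p\le p^{-1}$ for each eigenvalue $\lambda$ of $A$. Let $\widetilde{\mathrm{SL}}_2(\mathbb Z_p)$ be the set of those $A$ for which moreover $\log(\lambda^{\kappa(A)})\ne0$ for each eigenvalue $\lambda$ of $A$, where $\log x=\sum_{n\ge1}(-1)^{n-1}(x-1)^n/n$ is the $p$-adic logarithm. Finally, let $Vp(n,w)=\{A_{w_m}: m\ge0,\ w_n\text{ is a prefix of }\mathrm T^mw\}$, viewed as a set of matrices over $\mathbb Z_p$, and $Vp(w)=\bigcap_{n\ge1}\overline{Vp(n,w)}$ (closures in the $p$-adic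 topology). Claim: if $A_1,A_2\in\widetilde{\mathrm{SL}}_2(\mathbb Z_p)$ are such that the two eigenvectors of $A_1$ and the two eigenvectors of $A_2$ in $\mathbf P^1_{\overline{\mathbb Q}_p}$ are all distinct, and if $A_1,A_2\in Vp(w)$, then $(w,\mathbf x_p)\notin\mathbf{LMad}$ for every $\mathbf x_p\in\mathbf P^1_{\mathbb Q_p}$. -/

import Mathlib

namespace PLC

noncomputable section

/-- Infinite words over the positive integers; `w i` is the letter with (zero-based) index `i`. -/
abbrev Word : Type := ℕ → ℕ+

/-- The words over the alphabet `{1, …, N}`. -/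
def words (N : ℕ) : Set Word := {w | ∀ i, (w i : ℕ) ≤ N}

/-- The matrix `A_a = (0 1; 1 a)` of a letter. -/
def letterMatrix (a : ℕ+) : Matrix (Fin 2) (Fin 2) ℤ := !![0, 1; 1, (a : ℤ)]

/-- The matrix `A_{a₁} ⋯ A_{a_n}` of a finite word `a₁ … a_n`. -/
def wordMatrix (u : List ℕ+) : Matrix (Fin 2) (Fin 2) ℤ := (u.map letterMatrix).prod

/-- The prefix of length `n` of an infinite word. -/
def wordPrefix (w : Word) (n : ℕ) : List ℕ+ := (List.range n).map w

/-- The left shift on infinite words. -/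
def shift (w : Word) : Word := fun i => w (i + 1)

variable (p : ℕ) [Fact p.Prime]

/-- The projective line over the `p`-adic numbers. -/
abbrev ProjLine : Type := Projectivization ℚ_[p] (Fin 2 → ℚ_[p])

/-- The linear map of `ℚ_p²` given by the matrix `A_a`. -/
def letterMap (a : ℕ+) : (Fin 2 → ℚ_[p]) →ₗ[ℚ_[p]] (Fin 2 → ℚ_[p]) :=
  Matrix.toLin' ((letterMatrix a).map (Int.cast : ℤ → ℚ_[p]))

theorem letterMap_injective (a : ℕ+) : Function.Injective (letterMap p a) := by
  intro u v h
  have h0 := congrFun h 0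
  have h1 := congrFun h 1
  simp [letterMap, letterMatrix, Matrix.mulVec, dotProduct, Fin.sum_univ_two] at h0 h1
  rw [h0] at h1
  have h2 : u 0 = v 0 := add_right_cancel h1
  funext i
  fin_cases i
  · exact h2
  · exact h0

/-- The extended shift `T (w, q) = (T w, A_{a₁} q)`, where `a₁` is the first letter of `w`. -/
def extShift (x : Word × ProjLine p) : Word × ProjLine p :=
  (shift x.1, Projectivization.map (letterMap p (x.1 0)) (letterMap_injective p (x.1 0)) x.2)

/-- The points `(q₁ : q₂)` such that, for all integers `(a, b) ≠ (0, 0)`,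
`|a q₁ + b q₂|_p · min {|q₁|_p⁻¹, |q₂|_p⁻¹} ≥ min {|a|⁻², |b|⁻²} · ε`, with `0⁻¹ = ∞` inside
the minima.  The inequality is written with its denominators cleared; it is homogeneous
in `(q₁, q₂)` (see `mk_mem_PBadEps_iff`). -/
def PBadEps (ε : ℝ) : Set (ProjLine p) :=
  {q | ∀ a b : ℤ, (a, b) ≠ (0, 0) →
    ε * max ‖q.rep 0‖ ‖q.rep 1‖ ≤
      ‖(a : ℚ_[p]) * q.rep 0 + (b : ℚ_[p]) * q.rep 1‖ * max |(a : ℝ)| |(b : ℝ)| ^ 2}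

/-- Membership in `PBadEps` may be tested on any representative. -/
theorem mk_mem_PBadEps_iff (ε : ℝ) (v : Fin 2 → ℚ_[p]) (hv : v ≠ 0) :
    Projectivization.mk ℚ_[p] v hv ∈ PBadEps p ε ↔
      ∀ a b : ℤ, (a, b) ≠ (0, 0) →
        ε * max ‖v 0‖ ‖v 1‖ ≤
          ‖(a : ℚ_[p]) * v 0 + (b : ℚ_[p]) * v 1‖ * max |(a : ℝ)| |(b : ℝ)| ^ 2 := by
  obtain ⟨c, hc⟩ := Projectivization.exists_smul_eq_mk_rep ℚ_[p] v hv
  have hpos : 0 < ‖(c : ℚ_[p])‖ := norm_pos_iff.mpr c.ne_zero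
  unfold PBadEps
  rw [Set.mem_ofPred_eq, ← hc]
  refine forall_congr' fun a => forall_congr' fun b => imp_congr_right fun _ => ?_
  have e0 : (c • v) 0 = (c : ℚ_[p]) * v 0 := rfl
  have e1 : (c • v) 1 = (c : ℚ_[p]) * v 1 := rfl
  have e2 : (a : ℚ_[p]) * (c * v 0) + (b : ℚ_[p]) * (c * v 1) =
      c * ((a : ℚ_[p]) * v 0 + (b : ℚ_[p]) * v 1) := by ring
  rw [e0, e1, e2, norm_mul, norm_mul, norm_mul, ← mul_max_of_nonneg _ _ hpos.le,
    mul_left_comm, mul_assoc, mul_le_mul_iff_right₀ hpos]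

/-- The set `LMad_ε`: all pairs whose iterates `T^n (w, x_p)`, `n = 1, 2, …`, have their word over
the alphabet `{1, …, N}`, `N = [ε⁻¹] + 1`, and their point in `PBad_ε`. -/
def LMadEps (ε : ℝ) : Set (Word × ProjLine p) :=
  {x | ∀ n : ℕ, 1 ≤ n →
    ((extShift p)^[n] x).1 ∈ words (⌊ε⁻¹⌋₊ + 1) ∧ ((extShift p)^[n] x).2 ∈ PBadEps p ε}

/-- The set `LMad`: the union of the sets `LMad_ε` over `ε > 0`. -/
def LMad : Set (Word × ProjLine p) := {x | ∃ ε : ℝ, 0 < ε ∧ x ∈ LMadEps p ε}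

/-- The `2 × 2` matrices over `ℤ_p` with determinant `1` or `-1`. -/
def SLpm : Set (Matrix (Fin 2) (Fin 2) ℤ_[p]) := {A | A.det = 1 ∨ A.det = -1}

/-- The embedding of `ℤ_p` into the algebraic closure of `ℚ_p`. -/
def toAlgCl : ℤ_[p] →+* PadicAlgCl p :=
  (algebraMap ℚ_[p] (PadicAlgCl p)).comp PadicInt.Coe.ringHom

variable {p}

/-- A matrix over `ℤ_p` as an endomorphism of the plane over the algebraic closure of `ℚ_p`. -/
def endAlgCl (A : Matrix (Fin 2) (Fin 2) ℤ_[p]) :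
    Module.End (PadicAlgCl p) (Fin 2 → PadicAlgCl p) :=
  Matrix.toLin' (A.map (toAlgCl p))

/-- The eigenvectors of `A`, as points of the projective line over the algebraic closure
of `ℚ_p`. -/
def eigenpoints (A : Matrix (Fin 2) (Fin 2) ℤ_[p]) :
    Set (Projectivization (PadicAlgCl p) (Fin 2 → PadicAlgCl p)) :=
  {v | ∃ l : PadicAlgCl p, (endAlgCl A).HasEigenvector l v.rep}

variable (p) in
/-- The matrices in `SL₂^±(ℤ_p)` with two different eigenvectors in the projective line over the
algebraic closure of `ℚ_p`. -/
def SLpmOne : Set (Matrix (Fin 2) (Fin 2) ℤ_[p]) :=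
  {A | A ∈ SLpm p ∧ (eigenpoints A).Nontrivial}

/-- The `p`-adic logarithm `∑_{n ≥ 1} (-1)^(n-1) (x - 1)^n / n`, meaningful for `|x - 1|_p < 1`. -/
def padicLog (x : PadicAlgCl p) : PadicAlgCl p :=
  ∑' n : ℕ, (-1) ^ n * (x - 1) ^ (n + 1) / ((n : PadicAlgCl p) + 1)

/-- `κ(A)`: the least positive integer `k ≤ p²` with `|λ^k - 1|_p ≤ p⁻¹` for every
eigenvalue `λ` of `A`. -/
def kappa (A : Matrix (Fin 2) (Fin 2) ℤ_[p]) : ℕ :=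
  sInf {k : ℕ | 0 < k ∧ k ≤ p ^ 2 ∧
    ∀ l : PadicAlgCl p, (endAlgCl A).HasEigenvalue l → ‖l ^ k - 1‖ ≤ (p : ℝ)⁻¹}

variable (p) in
/-- The matrices `A` with two different eigenvectors such that `log (λ^κ(A)) ≠ 0` for
every eigenvalue `λ` of `A`. -/
def SLtilde : Set (Matrix (Fin 2) (Fin 2) ℤ_[p]) :=
  {A | A ∈ SLpmOne p ∧
    ∀ l : PadicAlgCl p, (endAlgCl A).HasEigenvalue l → padicLog (l ^ kappa A) ≠ 0}

variable (p) in
/-- `Vp(n, w)`: the matrices `A_{w_m}`, viewed over `ℤ_p`, of those prefixes `w_m` (`m ≥ 0`) of `w`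
for which the prefix `w_n` of `w` is also a prefix of `T^m w`. -/
def Vpn (n : ℕ) (w : Word) : Set (Matrix (Fin 2) (Fin 2) ℤ_[p]) :=
  {A | ∃ m : ℕ, wordPrefix (shift^[m] w) n = wordPrefix w n ∧
    A = (wordMatrix (wordPrefix w m)).map (Int.cast : ℤ → ℤ_[p])}

variable (p) in
/-- `Vp(w)`: the intersection over `n ≥ 1` of the `p`-adic closures of the sets `Vp(n, w)`. -/
def Vp (w : Word) : Set (Matrix (Fin 2) (Fin 2) ℤ_[p]) :=
  ⋂ (n : ℕ) (_ : 1 ≤ n), closure (Vpn p n w)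

end

end PLC

namespace PLC

open Filter Topology

noncomputable section

variable {p : ℕ} [hp : Fact p.Prime]

/-! ### Norms of natural numbers -/

/-! Suppose that `(w, xp)` lies in `LMad`, and let `v` span `xp`. Letter matrices are symmetric, so
`T^n` acts on the point by the transpose of `A_{w_n}`. If `w_n` is also a prefix of `T^m w`, the
transpose of `A_{w_m}` followed by that of `A_{w_n}` yields the iterate `m + n`, which is bad.
Badness is a closed condition, so the transpose of every `A ∈ Vp(w)` preserves the set of vectors
with bad orbit (`transpose_mulVec_mem_badOrbitVectors`).

Suppose that this transpose moves the line of `v`. A power `A^K` is congruent to `1` modulo `p²`;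
let `1 + E` be its transpose. No such power is scalar, since otherwise the eigenvalues would be
roots of unity and the logarithms would vanish (`pow_ne_smul_one_of_mem_SLtilde`); hence `1 + E`
moves the line too. In the coordinate `t` on the lines of `v + t E v`, the orbit of `v` is a
sequence with `|z_{k+m} - z_k| = |m|`, which is dense in `ℤ_p` (`add_smul_mem_of_orbit_mem`). So
every such line with `t ∈ ℤ_p` has a bad first iterate. One of these lines is rational
(`exists_int_relation`), and a nonzero integral linear form that vanishes on it contradicts badness.

Thus `v` is an eigenvector of both transposes, and turning it by a right angle gives a common
eigenvector of `A₁` and `A₂`. -/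

theorem norm_natCast_padicAlgCl (n : ℕ) : ‖(n : PadicAlgCl p)‖ = ‖(n : ℚ_[p])‖ := by
  rw [← map_natCast (algebraMap ℚ_[p] (PadicAlgCl p)), ← PadicAlgCl.norm_extends]

/-- The `p`-part of `n` divides `n`. Below, this bounds the reciprocal norm of a denominator `n` by
`n` itself. -/
theorem one_le_mul_norm_natCast {n : ℕ} (hn : n ≠ 0) : 1 ≤ (n : ℝ) * ‖(n : ℚ_[p])‖ := by
  have hnorm : ‖(n : ℚ_[p])‖ ≠ 0 := norm_ne_zero_iff.mpr (Nat.cast_ne_zero.mpr hn)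
  have hpos : 0 < ‖(n : ℚ_[p])‖ := lt_of_le_of_ne (norm_nonneg _) hnorm.symm
  rw [Padic.norm_eq_zpow_neg_valuation (Nat.cast_ne_zero.mpr hn), Padic.valuation_natCast,
    zpow_neg, zpow_natCast, ← div_eq_mul_inv, one_le_div (pow_pos (mod_cast hp.out.pos) _)]
  exact_mod_cast Nat.le_of_dvd (Nat.pos_of_ne_zero hn) pow_padicValNat_dvd

/-! ### The logarithm of a root of unity -/

/-- By Pascal's rule consecutive errors differ, up to sign, by `N.choose (j + 1) = N / (j + 1) * (N
- 1).choose j`, of norm at most `‖N‖ * (j + 1)`. -/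
theorem norm_choose_pred_sub_neg_one_pow_le (N : ℕ) (hN : N ≠ 0) (j : ℕ) (hj : j < N) :
    ‖((N - 1).choose j : PadicAlgCl p) - (-1) ^ j‖ ≤ ‖(N : ℚ_[p])‖ * (j + 1) := by
  obtain ⟨M, rfl⟩ := Nat.exists_eq_succ_of_ne_zero hN
  simp only [Nat.succ_eq_add_one, Nat.add_sub_cancel] at *
  induction j with
  | zero => simp
  | succ j ih =>
    have ih := ih (by omega)
    have e : (M.choose (j + 1) : PadicAlgCl p) - (-1) ^ (j + 1) =
        ((M + 1).choose (j + 1) : ℕ) - ((M.choose j : PadicAlgCl p) - (-1) ^ j) := by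
      rw [Nat.choose_succ_succ]; push_cast; ring
    have hc : ‖(((M + 1).choose (j + 1) : ℕ) : PadicAlgCl p)‖ ≤ ‖((M + 1 : ℕ) : ℚ_[p])‖ * (j + 1) := by
      rw [norm_natCast_padicAlgCl]
      have h := congrArg (fun n : ℕ => ‖(n : ℚ_[p])‖) (Nat.add_one_mul_choose_eq M j)
      simp only [Nat.cast_mul, norm_mul] at h
      have h1 := one_le_mul_norm_natCast (p := p) (Nat.succ_ne_zero j)
      have h2 : ‖(M.choose j : ℚ_[p])‖ ≤ 1 := mod_cast Padic.norm_int_le_one (M.choose j)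
      set c := ‖(((M + 1).choose (j + 1) : ℕ) : ℚ_[p])‖
      have hc0 : 0 ≤ c := norm_nonneg _
      calc c ≤ c * (((j + 1 : ℕ) : ℝ) * ‖((j + 1 : ℕ) : ℚ_[p])‖) := le_mul_of_one_le_right hc0 h1
        _ = (c * ‖((j + 1 : ℕ) : ℚ_[p])‖) * (j + 1) := by push_cast; ring
        _ ≤ ‖((M + 1 : ℕ) : ℚ_[p])‖ * (j + 1) := by
          rw [← h]
          gcongr
          exact mul_le_of_le_one_right (norm_nonneg _) h2
    rw [e, sub_eq_add_neg]
    refine (IsUltrametricDist.norm_add_le_max _ _).trans (max_le ?_ ?_)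
    · refine hc.trans ?_
      push_cast
      gcongr
      linarith
    · rw [norm_neg]
      refine ih.trans ?_
      push_cast
      gcongr
      linarith

theorem sq_le_two_mul_two_pow (k : ℕ) : k ^ 2 ≤ 2 * 2 ^ k := by
  rcases lt_or_ge k 4 with h | h
  · interval_cases k <;> norm_num
  · induction k, h using Nat.le_induction with
    | base => norm_num
    | succ k hk ih => rw [pow_succ 2]; nlinarith

/-- Dividing the binomial expansion of `(1 + y) ^ N - 1 = 0` by `N` gives a vanishing sum that
differs from the partial sum of the logarithm only in having `(N - 1).choose j` for `(-1) ^ j`. -/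
theorem norm_log_partial_sum_le {y : PadicAlgCl p} (hy : ‖y‖ ≤ (p : ℝ)⁻¹) {N : ℕ} (hN : N ≠ 0)
    (h1 : (1 + y) ^ N = 1) :
    ‖∑ j ∈ Finset.range N, (-1) ^ j * y ^ (j + 1) / ((j : PadicAlgCl p) + 1)‖ ≤
      ‖(N : ℚ_[p])‖ * 2 := by
  have hz : ∑ j ∈ Finset.range N,
      ((N - 1).choose j : PadicAlgCl p) * y ^ (j + 1) / ((j : PadicAlgCl p) + 1) = 0 := by
    have hN' : (N : PadicAlgCl p) ≠ 0 := Nat.cast_ne_zero.mpr hN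
    apply mul_left_cancel₀ hN'
    rw [add_comm, add_pow, Finset.sum_range_succ'] at h1
    simp only [one_pow, mul_one, pow_zero, Nat.choose_zero_right, Nat.cast_one,
      add_eq_right] at h1
    rw [mul_zero, ← h1, Finset.mul_sum]
    refine Finset.sum_congr rfl fun j _ => ?_
    have hj : ((j : PadicAlgCl p) + 1) ≠ 0 := Nat.cast_add_one_ne_zero j
    have h := congrArg (Nat.cast : ℕ → PadicAlgCl p) (Nat.add_one_mul_choose_eq (N - 1) j)
    rw [Nat.sub_add_cancel (Nat.one_le_iff_ne_zero.mpr hN)] at h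
    push_cast at h
    field_simp
    linear_combination (y ^ (j + 1)) * h
  rw [← sub_zero (∑ j ∈ Finset.range N, _), ← hz, ← Finset.sum_sub_distrib]
  refine IsUltrametricDist.norm_sum_le_of_forall_le_of_nonneg (by positivity) fun j hj => ?_
  have e : (-1) ^ j * y ^ (j + 1) / ((j : PadicAlgCl p) + 1) -
      ((N - 1).choose j : PadicAlgCl p) * y ^ (j + 1) / ((j : PadicAlgCl p) + 1) =
      -((((N - 1).choose j : PadicAlgCl p) - (-1) ^ j) * y ^ (j + 1) / ((j + 1 : ℕ) : PadicAlgCl p)) := by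
    push_cast; ring
  rw [e, norm_neg, norm_div, norm_mul, norm_pow, norm_natCast_padicAlgCl]
  have hc := norm_choose_pred_sub_neg_one_pow_le (p := p) N hN j (Finset.mem_range.mp hj)
  have h1 := one_le_mul_norm_natCast (p := p) (Nat.succ_ne_zero j)
  have hpos : 0 < ‖((j + 1 : ℕ) : ℚ_[p])‖ :=
    norm_pos_iff.mpr (Nat.cast_ne_zero.mpr (Nat.succ_ne_zero j))
  have hy2 : ‖y‖ ≤ 2⁻¹ := hy.trans (by
    gcongr
    exact_mod_cast hp.out.two_le)
  have h2 : ((j + 1 : ℕ) : ℝ) ^ 2 * ‖y‖ ^ (j + 1) ≤ 2 := by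
    calc ((j + 1 : ℕ) : ℝ) ^ 2 * ‖y‖ ^ (j + 1) ≤ (2 * 2 ^ (j + 1)) * (2⁻¹) ^ (j + 1) := by
          gcongr
          exact_mod_cast sq_le_two_mul_two_pow (j + 1)
      _ = 2 := by rw [mul_assoc, ← mul_pow]; norm_num
  rw [div_le_iff₀ hpos]
  calc _ ≤ (‖(N : ℚ_[p])‖ * (j + 1)) * ‖y‖ ^ (j + 1) := by gcongr
    _ ≤ (‖(N : ℚ_[p])‖ * (j + 1)) * ‖y‖ ^ (j + 1) *
        (((j + 1 : ℕ) : ℝ) * ‖((j + 1 : ℕ) : ℚ_[p])‖) :=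
      le_mul_of_one_le_right (by positivity) h1
    _ = ‖(N : ℚ_[p])‖ * (((j + 1 : ℕ) : ℝ) ^ 2 * ‖y‖ ^ (j + 1)) * ‖((j + 1 : ℕ) : ℚ_[p])‖ := by
      push_cast; ring
    _ ≤ _ := by gcongr

/-- A root of unity of order prime to `p` that is congruent to `1` is equal to `1`. -/
theorem eq_one_of_pow_eq_one_of_norm_sub_one_lt {z : PadicAlgCl p} (hz : ‖z - 1‖ < 1) {m : ℕ}
    (hm : ¬ p ∣ m) (h : z ^ m = 1) : z = 1 := by
  have hz1 : ‖z‖ ≤ 1 := by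
    have := IsUltrametricDist.norm_add_le_max (z - 1) 1
    rw [sub_add_cancel, norm_one, max_eq_right hz.le] at this
    exact this
  have hpow : ∀ i : ℕ, ‖z ^ i - 1‖ ≤ ‖z - 1‖ := fun i => by
    rw [← mul_geom_sum, norm_mul]
    refine mul_le_of_le_one_right (norm_nonneg _)
      (IsUltrametricDist.norm_sum_le_of_forall_le_of_nonneg zero_le_one fun i _ => ?_)
    rw [norm_pow]
    exact pow_le_one₀ (norm_nonneg _) hz1
  -- All powers of `z` are congruent to `1`, so the sum is congruent to `m`, a `p`-adic unit.
  have hne : ∑ i ∈ Finset.range m, z ^ i ≠ 0 := by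
    intro h0
    have e : ∑ i ∈ Finset.range m, (z ^ i - 1) = -(m : PadicAlgCl p) := by
      simp [Finset.sum_sub_distrib, h0]
    have h1 : ‖(m : PadicAlgCl p)‖ = 1 := by
      rw [norm_natCast_padicAlgCl]
      exact Padic.norm_natCast_eq_one_iff.mpr ((Nat.Prime.coprime_iff_not_dvd hp.out).mpr hm)
    have h2 : ‖∑ i ∈ Finset.range m, (z ^ i - 1)‖ ≤ ‖z - 1‖ :=
      IsUltrametricDist.norm_sum_le_of_forall_le_of_nonneg (norm_nonneg _) fun i _ => hpow i
    rw [e, norm_neg, h1] at h2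
    exact absurd h2 (not_le.mpr hz)
  have := mul_geom_sum z m
  rw [h, sub_self] at this
  exact sub_eq_zero.mp ((mul_eq_zero.mp this).resolve_right hne)

theorem padicLog_eq_zero_of_pow_eq_one {x : PadicAlgCl p} (hx : ‖x - 1‖ ≤ (p : ℝ)⁻¹) {K : ℕ}
    (hK : K ≠ 0) (h : x ^ K = 1) : padicLog x = 0 := by
  obtain ⟨n, m, hm, rfl⟩ := Nat.exists_eq_pow_mul_and_not_dvd hK p hp.out.ne_one
  have hlt : ‖x - 1‖ < 1 := hx.trans_lt (inv_lt_one_of_one_lt₀ (mod_cast hp.out.one_lt))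
  have hx1 : ‖x‖ ≤ 1 := by
    have := IsUltrametricDist.norm_add_le_max (x - 1) 1
    rw [sub_add_cancel, norm_one, max_eq_right hlt.le] at this
    exact this
  have hpn : x ^ p ^ n = 1 := by
    refine eq_one_of_pow_eq_one_of_norm_sub_one_lt ?_ hm (by rw [← pow_mul]; exact h)
    rw [← mul_geom_sum, norm_mul]
    refine (mul_le_of_le_one_right (norm_nonneg _)
      (IsUltrametricDist.norm_sum_le_of_forall_le_of_nonneg zero_le_one fun i _ => ?_)).trans_lt hlt
    rw [norm_pow]
    exact pow_le_one₀ (norm_nonneg _) hx1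
  unfold padicLog
  -- A divergent `tsum` is `0` by convention, so convergence need not be proved. Otherwise the
  -- partial sums of length `p ^ k` determine the limit, and their norms are at most `2 * p⁻ᵏ` for
  -- large `k`.
  by_cases hs : Summable fun n : ℕ => (-1) ^ n * (x - 1) ^ (n + 1) / ((n : PadicAlgCl p) + 1)
  swap
  · exact tsum_eq_zero_of_not_summable hs
  have hsub : Tendsto (fun k => p ^ k) atTop atTop :=
    tendsto_pow_atTop_atTop_of_one_lt hp.out.one_lt
  have ht := hs.hasSum.tendsto_sum_nat.comp hsub
  refine tendsto_nhds_unique ht ?_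
  have hb : Tendsto (fun k : ℕ => ((p : ℝ)⁻¹) ^ k * 2) atTop (𝓝 (0 * 2)) :=
    (tendsto_pow_atTop_nhds_zero_of_lt_one (by positivity)
      (inv_lt_one_of_one_lt₀ (mod_cast hp.out.one_lt))).mul_const 2
  rw [zero_mul] at hb
  refine squeeze_zero_norm' ?_ hb
  filter_upwards [eventually_ge_atTop n] with k hk
  have h1 : (1 + (x - 1)) ^ p ^ k = 1 := by
    rw [add_sub_cancel, ← Nat.add_sub_cancel' hk, pow_add, pow_mul, hpn, one_pow]
  have := norm_log_partial_sum_le hx (pow_ne_zero k hp.out.ne_zero) h1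
  rwa [Nat.cast_pow, norm_pow, Padic.norm_p] at this

/-! ### The determinant of a pair of plane vectors -/

/-- The determinant of the pair of plane vectors `u`, `v`. -/
def wedge {R : Type*} [CommRing R] (u v : Fin 2 → R) : R := u 0 * v 1 - u 1 * v 0

section wedge

variable {R : Type*} [CommRing R]

theorem wedge_self (u : Fin 2 → R) : wedge u u = 0 := by unfold wedge; ring

theorem wedge_mulVec (A : Matrix (Fin 2) (Fin 2) R) (u v : Fin 2 → R) :
    wedge (A.mulVec u) (A.mulVec v) = A.det * wedge u v := by
  simp only [wedge, Matrix.mulVec, dotProduct, Fin.sum_univ_two, Matrix.det_fin_two]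
  ring

/-- Cramer's rule. -/
theorem wedge_smul_add (x y v : Fin 2 → R) :
    wedge v y • x + wedge x v • y = wedge x y • v := by
  ext i
  fin_cases i <;> simp [wedge] <;> ring

/-- Cayley–Hamilton, applied to `v` and paired with `x`. -/
theorem wedge_mulVec_mulVec (A : Matrix (Fin 2) (Fin 2) R) (x v : Fin 2 → R) :
    wedge x (A.mulVec (A.mulVec v)) =
      A.trace * wedge x (A.mulVec v) - A.det * wedge x v := by
  simp only [wedge, Matrix.mulVec, dotProduct, Fin.sum_univ_two, Matrix.det_fin_two,
    Matrix.trace_fin_two]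
  ring

theorem wedge_sum_smul_right {ι : Type*} (s : Finset ι) (c : ι → R) (f : ι → Fin 2 → R)
    (x : Fin 2 → R) : wedge x (∑ i ∈ s, c i • f i) = ∑ i ∈ s, c i * wedge x (f i) := by
  simp only [wedge, Finset.sum_apply, Pi.smul_apply, smul_eq_mul, Finset.mul_sum,
    ← Finset.sum_sub_distrib]
  exact Finset.sum_congr rfl fun i _ => by ring

theorem wedge_neg_swap (u v : Fin 2 → R) : -wedge v u = wedge u v := by unfold wedge; ring

theorem one_add_pow_mulVec (E : Matrix (Fin 2) (Fin 2) R) (m : ℕ) (x : Fin 2 → R) :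
    ((1 + E) ^ m).mulVec x =
      ∑ j ∈ Finset.range (m + 1), (m.choose j : R) • (E ^ j).mulVec x := by
  rw [add_comm 1 E, (Commute.one_right E).add_pow, Matrix.sum_mulVec]
  refine Finset.sum_congr rfl fun j _ => ?_
  rw [one_pow, mul_one, ← nsmul_eq_mul', ← Nat.cast_smul_eq_nsmul R, Matrix.smul_mulVec]

end wedge

/-! ### Powers of a matrix congruent to the identity -/


theorem inv_sq_le_quarter : ((p : ℝ) ^ 2)⁻¹ ≤ 4⁻¹ := by
  gcongr
  have : (2 : ℝ) ≤ p := mod_cast hp.out.two_le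
  nlinarith

theorem norm_trace_le {E : Matrix (Fin 2) (Fin 2) ℚ_[p]} {q : ℝ} (hE : ∀ i j, ‖E i j‖ ≤ q) :
    ‖E.trace‖ ≤ q := by
  rw [Matrix.trace_fin_two]
  exact (IsUltrametricDist.norm_add_le_max _ _).trans (max_le (hE _ _) (hE _ _))

theorem norm_det_le {E : Matrix (Fin 2) (Fin 2) ℚ_[p]} {q : ℝ} (hE : ∀ i j, ‖E i j‖ ≤ q) :
    ‖E.det‖ ≤ q ^ 2 := by
  have hq : 0 ≤ q := (norm_nonneg _).trans (hE 0 0)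
  rw [Matrix.det_fin_two, sub_eq_add_neg]
  refine (IsUltrametricDist.norm_add_le_max _ _).trans (max_le ?_ ?_)
  · rw [norm_mul, sq]
    exact mul_le_mul (hE _ _) (hE _ _) (norm_nonneg _) hq
  · rw [norm_neg, norm_mul, sq]
    exact mul_le_mul (hE _ _) (hE _ _) (norm_nonneg _) hq

/-- The numbers `wedge x (E ^ j x)` satisfy a recurrence of order two with coefficients `trace E`
and `-det E`, of norms at most `q` and `q ^ 2`. The second bound carries the preceding term through
the induction. -/
theorem norm_wedge_pow_mulVec_le {E : Matrix (Fin 2) (Fin 2) ℚ_[p]} {q : ℝ}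
    (hE : ∀ i j, ‖E i j‖ ≤ q) (x : Fin 2 → ℚ_[p]) (j : ℕ) :
    ‖wedge x ((E ^ (j + 1)).mulVec x)‖ ≤ q ^ j * ‖wedge x (E.mulVec x)‖ ∧
      q * ‖wedge x ((E ^ j).mulVec x)‖ ≤ q ^ j * ‖wedge x (E.mulVec x)‖ := by
  have hq : 0 ≤ q := (norm_nonneg _).trans (hE 0 0)
  induction j with
  | zero => simp [wedge_self]
  | succ j ih =>
    obtain ⟨h1, h2⟩ := ih
    refine ⟨?_, ?_⟩
    · have e : (E ^ (j + 1 + 1)).mulVec x = E.mulVec (E.mulVec ((E ^ j).mulVec x)) := by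
        rw [pow_succ', pow_succ', Matrix.mulVec_mulVec, Matrix.mulVec_mulVec, mul_assoc]
      have e1 : (E ^ (j + 1)).mulVec x = E.mulVec ((E ^ j).mulVec x) := by
        rw [Matrix.mulVec_mulVec, ← pow_succ']
      rw [e, wedge_mulVec_mulVec, ← e1, sub_eq_add_neg]
      refine (IsUltrametricDist.norm_add_le_max _ _).trans (max_le ?_ ?_)
      · rw [norm_mul, pow_succ' q, mul_assoc]
        exact mul_le_mul (norm_trace_le hE) h1 (norm_nonneg _) hq
      · rw [norm_neg, norm_mul, pow_succ' q, mul_assoc]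
        calc _ ≤ q ^ 2 * ‖wedge x ((E ^ j).mulVec x)‖ := by
              gcongr
              exact norm_det_le hE
          _ = q * (q * ‖wedge x ((E ^ j).mulVec x)‖) := by ring
          _ ≤ _ := by gcongr
    · rw [pow_succ' q, mul_assoc]
      gcongr

theorem add_two_le_two_pow (j : ℕ) : ((j : ℝ) + 2) ≤ 2⁻¹ * 4 ^ (j + 1) := by
  induction j with
  | zero => norm_num
  | succ j ih => rw [pow_succ]; push_cast; linarith

/-- In the binomial expansion the linear term `m * wedge x (E x)` strictly dominates: for `j ≥ 2`
the term of order `j` is smaller by a factor of at most `j * 4⁻¹ ^ (j - 1) ≤ 1 / 2`. Congruence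
modulo `p²` supplies the `4⁻¹` even when `p = 2`. -/
theorem norm_wedge_one_add_pow {E : Matrix (Fin 2) (Fin 2) ℚ_[p]}
    (hE : ∀ i j, ‖E i j‖ ≤ ((p : ℝ) ^ 2)⁻¹) (x : Fin 2 → ℚ_[p]) (m : ℕ) :
    ‖wedge x (((1 + E) ^ m).mulVec x)‖ = ‖(m : ℚ_[p])‖ * ‖wedge x (E.mulVec x)‖ := by
  have hE4 : ∀ i j, ‖E i j‖ ≤ 4⁻¹ := fun i j => (hE i j).trans inv_sq_le_quarter
  rcases Nat.eq_zero_or_pos m with rfl | hm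
  · simp [wedge_self]
  obtain ⟨M, rfl⟩ := Nat.exists_eq_succ_of_ne_zero hm.ne'
  rcases eq_or_ne (wedge x (E.mulVec x)) 0 with h0 | h0
  · have hz : ∀ j, wedge x ((E ^ j).mulVec x) = 0 := by
      intro j
      cases j with
      | zero => simp [wedge_self]
      | succ j =>
        have := (norm_wedge_pow_mulVec_le hE4 x j).1
        rw [h0, norm_zero, mul_zero] at this
        exact norm_le_zero_iff.mp this
    rw [one_add_pow_mulVec, wedge_sum_smul_right]
    rw [h0, norm_zero, mul_zero, Finset.sum_eq_zero fun j _ => by rw [hz, mul_zero], norm_zero]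
  rw [one_add_pow_mulVec, wedge_sum_smul_right, Finset.sum_range_succ', Finset.sum_range_succ']
  simp only [zero_add, pow_zero, Matrix.one_mulVec, wedge_self, mul_zero, add_zero, pow_one,
    Nat.choose_one_right, Nat.succ_eq_add_one]
  set G := ‖wedge x (E.mulVec x)‖ with hG
  have hGpos : 0 < G := norm_pos_iff.mpr h0
  have hMpos : 0 < ‖((M + 1 : ℕ) : ℚ_[p])‖ :=
    norm_pos_iff.mpr (Nat.cast_ne_zero.mpr (Nat.succ_ne_zero M))
  have hsmall : ‖∑ j ∈ Finset.range M, ((M + 1).choose (j + 1 + 1) : ℚ_[p]) *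
      wedge x ((E ^ (j + 1 + 1)).mulVec x)‖ ≤ 2⁻¹ * (‖((M + 1 : ℕ) : ℚ_[p])‖ * G) := by
    refine IsUltrametricDist.norm_sum_le_of_forall_le_of_nonneg (by positivity) fun j _ => ?_
    have h := congrArg (fun n : ℕ => ‖(n : ℚ_[p])‖) (Nat.add_one_mul_choose_eq M (j + 1))
    simp only [Nat.cast_mul, norm_mul] at h
    have h1 := one_le_mul_norm_natCast (p := p) (Nat.succ_ne_zero (j + 1))
    have h2 : ‖(M.choose (j + 1) : ℚ_[p])‖ ≤ 1 := mod_cast Padic.norm_int_le_one (M.choose (j + 1))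
    have h3 := (norm_wedge_pow_mulVec_le hE4 x (j + 1)).1
    rw [norm_mul]
    set c := ‖(((M + 1).choose (j + 1 + 1) : ℕ) : ℚ_[p])‖
    have hc : c ≤ ‖((M + 1 : ℕ) : ℚ_[p])‖ * (j + 2) := by
      calc c ≤ c * (((j + 1 + 1 : ℕ) : ℝ) * ‖((j + 1 + 1 : ℕ) : ℚ_[p])‖) :=
            le_mul_of_one_le_right (norm_nonneg _) h1
        _ = (c * ‖((j + 1 + 1 : ℕ) : ℚ_[p])‖) * (j + 2) := by push_cast; ring
        _ ≤ _ := by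
          rw [← h]
          gcongr
          exact mul_le_of_le_one_right (norm_nonneg _) h2
    calc _ ≤ (‖((M + 1 : ℕ) : ℚ_[p])‖ * (j + 2)) * (4⁻¹ ^ (j + 1) * G) := by gcongr
      _ ≤ (‖((M + 1 : ℕ) : ℚ_[p])‖ * (2⁻¹ * 4 ^ (j + 1))) * (4⁻¹ ^ (j + 1) * G) := by
        gcongr
        exact add_two_le_two_pow j
      _ = 2⁻¹ * (‖((M + 1 : ℕ) : ℚ_[p])‖ * G) * (4 * 4⁻¹) ^ (j + 1) := by rw [mul_pow]; ring
      _ = _ := by norm_num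
  have hmain : ‖((M + 1 : ℕ) : ℚ_[p]) * wedge x (E.mulVec x)‖ = ‖((M + 1 : ℕ) : ℚ_[p])‖ * G :=
    norm_mul _ _
  have hlt : ‖∑ j ∈ Finset.range M, ((M + 1).choose (j + 1 + 1) : ℚ_[p]) *
      wedge x ((E ^ (j + 1 + 1)).mulVec x)‖ < ‖((M + 1 : ℕ) : ℚ_[p]) * wedge x (E.mulVec x)‖ := by
    rw [hmain]
    have : 0 < ‖((M + 1 : ℕ) : ℚ_[p])‖ * G := mul_pos hMpos hGpos
    linarith
  rw [IsUltrametricDist.norm_add_eq_max_of_norm_ne_norm hlt.ne, max_eq_right hlt.le, hmain]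

/-- Every term after the first contains `wedge (E x) (E ^ (j + 1) x) = det E * wedge x (E ^ j x)`,
which is strictly smaller than the first. -/
theorem norm_wedge_one_add_pow_left {E : Matrix (Fin 2) (Fin 2) ℚ_[p]}
    (hE : ∀ i j, ‖E i j‖ ≤ ((p : ℝ) ^ 2)⁻¹) (x : Fin 2 → ℚ_[p])
    (hx : wedge x (E.mulVec x) ≠ 0) (m : ℕ) :
    ‖wedge (((1 + E) ^ m).mulVec x) (E.mulVec x)‖ = ‖wedge x (E.mulVec x)‖ := by
  have hE4 : ∀ i j, ‖E i j‖ ≤ 4⁻¹ := fun i j => (hE i j).trans inv_sq_le_quarter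
  rw [← wedge_neg_swap, norm_neg, one_add_pow_mulVec, wedge_sum_smul_right,
    Finset.sum_range_succ']
  simp only [Nat.choose_zero_right, Nat.cast_one, one_mul, pow_zero, Matrix.one_mulVec]
  rw [← norm_neg (wedge x _), wedge_neg_swap]
  have hGpos : 0 < ‖wedge (E.mulVec x) x‖ := by
    rw [← wedge_neg_swap, norm_neg]
    exact norm_pos_iff.mpr hx
  have hlt : ‖∑ j ∈ Finset.range m, (m.choose (j + 1) : ℚ_[p]) *
      wedge (E.mulVec x) ((E ^ (j + 1)).mulVec x)‖ < ‖wedge (E.mulVec x) x‖ := by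
    refine (IsUltrametricDist.norm_sum_le_of_forall_le_of_nonneg
      (C := 4⁻¹ * ‖wedge (E.mulVec x) x‖) (by positivity) fun j _ => ?_).trans_lt (by linarith)
    have h2 : ‖(m.choose (j + 1) : ℚ_[p])‖ ≤ 1 := mod_cast Padic.norm_int_le_one (m.choose (j + 1))
    have e1 : (E ^ (j + 1)).mulVec x = E.mulVec ((E ^ j).mulVec x) := by
      rw [Matrix.mulVec_mulVec, ← pow_succ']
    have h3 := (norm_wedge_pow_mulVec_le hE4 x j).2
    have h4 : (4⁻¹ : ℝ) ^ j ≤ 1 := pow_le_one₀ (by norm_num) (by norm_num)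
    rw [norm_mul, e1, wedge_mulVec, norm_mul]
    rw [← wedge_neg_swap (E.mulVec x), norm_neg]
    calc _ ≤ 1 * ((4⁻¹) ^ 2 * ‖wedge x ((E ^ j).mulVec x)‖) := by
          gcongr
          exact norm_det_le hE4
      _ = 4⁻¹ * (4⁻¹ * ‖wedge x ((E ^ j).mulVec x)‖) := by ring
      _ ≤ 4⁻¹ * (1 * ‖wedge x (E.mulVec x)‖) := by
        gcongr 4⁻¹ * ?_
        exact h3.trans (by gcongr)
      _ = _ := by ring
  rw [IsUltrametricDist.norm_add_eq_max_of_norm_ne_norm hlt.ne, max_eq_right hlt.le]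

/-! ### Orbit closures, rational lines and reduction modulo `p²` -/

/-- A sequence of `p`-adic integers that preserves `p`-adic distances is dense. -/
theorem denseRange_of_norm_sub_eq (z : ℕ → ℤ_[p])
    (hz : ∀ k m : ℕ, ‖z (k + m) - z k‖ = ‖(m : ℤ_[p])‖) : DenseRange z := by
  have key : ∀ n k m : ℕ, PadicInt.toZModPow n (z (k + m)) = PadicInt.toZModPow n (z k) →
      p ^ n ∣ m := by
    intro n k m h
    rw [← sub_eq_zero, ← map_sub, ← RingHom.mem_ker, PadicInt.ker_toZModPow,
      ← PadicInt.norm_le_pow_iff_mem_span_pow, hz] at h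
    have h' : ‖((m : ℤ) : ℤ_[p])‖ ≤ (p : ℝ) ^ (-(n : ℤ)) := by rwa [Int.cast_natCast]
    exact_mod_cast PadicInt.norm_int_le_pow_iff_dvd.mp h'
  -- The first `p ^ n` terms are pairwise incongruent modulo `p ^ n`, hence they meet every residue
  -- class.
  have hsurj : ∀ n : ℕ, Function.Surjective
      (fun a : ZMod (p ^ n) => PadicInt.toZModPow n (z a.val)) := by
    intro n
    have : NeZero (p ^ n) := ⟨pow_ne_zero n hp.out.ne_zero⟩
    refine Finite.injective_iff_surjective.mp ?_
    have aux : ∀ a b : ZMod (p ^ n), a.val ≤ b.val →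
        PadicInt.toZModPow n (z a.val) = PadicInt.toZModPow n (z b.val) → a = b := by
      intro a b hab h
      rw [← Nat.add_sub_cancel' hab] at h
      have hd := key n _ _ h.symm
      have hb := b.val_lt
      have := Nat.eq_zero_of_dvd_of_lt hd (by omega)
      exact ZMod.val_injective _ (by omega)
    intro a b h
    rcases le_total a.val b.val with hab | hab
    · exact aux a b hab h
    · exact (aux b a hab h.symm).symm
  rw [Metric.denseRange_iff]
  intro t r hr
  obtain ⟨n, hn⟩ := PadicInt.exists_pow_neg_lt p hr
  obtain ⟨a, ha⟩ := hsurj n (PadicInt.toZModPow n t)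
  refine ⟨a.val, lt_of_le_of_lt ?_ hn⟩
  rw [dist_eq_norm, PadicInt.norm_le_pow_iff_mem_span_pow, ← PadicInt.ker_toZModPow,
    RingHom.mem_ker, map_sub, sub_eq_zero]
  exact ha.symm

/-- The closure of the projective orbit of `x` under a matrix `1 + E` close to the identity
contains the points `x + t E x` with `t` integral. -/
theorem add_smul_mem_of_orbit_mem {E : Matrix (Fin 2) (Fin 2) ℚ_[p]}
    (hE : ∀ i j, ‖E i j‖ ≤ ((p : ℝ) ^ 2)⁻¹) (hdet : ‖(1 + E).det‖ = 1) {x : Fin 2 → ℚ_[p]}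
    (hx : wedge x (E.mulVec x) ≠ 0) {C : Set (Fin 2 → ℚ_[p])} (hC : IsClosed C)
    (hsmul : ∀ c : ℚ_[p], ∀ v ∈ C, c • v ∈ C) (horb : ∀ k : ℕ, ((1 + E) ^ k).mulVec x ∈ C)
    (t : ℤ_[p]) : x + (t : ℚ_[p]) • E.mulVec x ∈ C := by
  set y := E.mulVec x with hy
  let v : ℕ → Fin 2 → ℚ_[p] := fun k => ((1 + E) ^ k).mulVec x
  have hG : ‖wedge x y‖ ≠ 0 := norm_ne_zero_iff.mpr hx
  have hβ : ∀ k, ‖wedge (v k) y‖ = ‖wedge x y‖ := norm_wedge_one_add_pow_left hE x hx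
  have hβ0 : ∀ k, wedge (v k) y ≠ 0 := fun k => norm_ne_zero_iff.mp (by rw [hβ k]; exact hG)
  have hα : ∀ k, ‖wedge x (v k)‖ = ‖(k : ℚ_[p])‖ * ‖wedge x y‖ := norm_wedge_one_add_pow hE x
  have hv : ∀ k m, ‖wedge (v k) (v (k + m))‖ = ‖(m : ℚ_[p])‖ * ‖wedge x y‖ := by
    intro k m
    have : v (k + m) = ((1 + E) ^ k).mulVec (v m) := by
      simp only [v, Matrix.mulVec_mulVec, pow_add]
    rw [this, wedge_mulVec, norm_mul, Matrix.det_pow, norm_pow, hdet, one_pow, one_mul, hα]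
  have hle : ∀ k, ‖wedge x (v k) / wedge (v k) y‖ ≤ 1 := by
    intro k
    rw [norm_div, hα, hβ, mul_div_cancel_right₀ _ hG]
    exact_mod_cast Padic.norm_int_le_one k
  -- By Cramer's rule `v k` is proportional to `x + z k • y`.
  let z : ℕ → ℤ_[p] := fun k => ⟨wedge x (v k) / wedge (v k) y, hle k⟩
  have hz : ∀ k m : ℕ, ‖z (k + m) - z k‖ = ‖(m : ℤ_[p])‖ := by
    intro k m
    rw [PadicInt.norm_def, PadicInt.norm_def, PadicInt.coe_sub, PadicInt.coe_natCast]
    -- The numerator is given by the Plücker relation between `x`, `y`, `v k` and `v (k + m)`.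
    have e : wedge x (v (k + m)) / wedge (v (k + m)) y - wedge x (v k) / wedge (v k) y =
        (wedge x y * wedge (v k) (v (k + m))) / (wedge (v (k + m)) y * wedge (v k) y) := by
      rw [div_sub_div _ _ (hβ0 _) (hβ0 _)]
      congr 1
      unfold wedge
      ring
    change ‖wedge x (v (k + m)) / wedge (v (k + m)) y - wedge x (v k) / wedge (v k) y‖ = _
    rw [e, norm_div, norm_mul, norm_mul, hβ, hβ, hv]
    field_simp
  have hmem : ∀ k, x + ((z k : ℤ_[p]) : ℚ_[p]) • y ∈ C := by
    intro k
    have e : x + (wedge x (v k) / wedge (v k) y) • y = (wedge x y / wedge (v k) y) • v k := by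
      have h := wedge_smul_add x y (v k)
      have h' := congrArg (fun u => (wedge (v k) y)⁻¹ • u) h
      simp only [smul_add, smul_smul, inv_mul_cancel₀ (hβ0 k), one_smul] at h'
      rw [div_eq_inv_mul, div_eq_inv_mul, h']
    change x + (wedge x (v k) / wedge (v k) y) • y ∈ C
    rw [e]
    exact hsmul _ _ (horb k)
  have hclosed : IsClosed {s : ℤ_[p] | x + (s : ℚ_[p]) • y ∈ C} :=
    hC.preimage (continuous_const.add (continuous_subtype_val.smul continuous_const))
  exact (denseRange_of_norm_sub_eq z hz).induction_on
    (p := fun s : ℤ_[p] => x + (s : ℚ_[p]) • y ∈ C) t hclosed hmem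

/-- Among the lines spanned by `x + t y`, `t` integral, there is a rational one. -/
theorem exists_int_relation {x y : Fin 2 → ℚ_[p]} (h : wedge x y ≠ 0) :
    ∃ (t : ℤ_[p]) (c d : ℤ), (c, d) ≠ (0, 0) ∧
      (c : ℚ_[p]) * (x + (t : ℚ_[p]) • y) 0 + (d : ℚ_[p]) * (x + (t : ℚ_[p]) • y) 1 = 0 := by
  have hopen : IsOpen {s : ℚ_[p] × ℚ_[p] | ‖s.1 * x 0 + s.2 * x 1‖ < ‖s.1 * y 0 + s.2 * y 1‖} :=
    isOpen_lt (by fun_prop) (by fun_prop)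
  have hne : {s : ℚ_[p] × ℚ_[p] |
      ‖s.1 * x 0 + s.2 * x 1‖ < ‖s.1 * y 0 + s.2 * y 1‖}.Nonempty := by
    -- This form kills `x` but not `y`. For a rational form near it, with values `X` on `x` and `Y`
    -- on `y`, the root `t = -X / Y` is integral.
    refine ⟨(-x 1, x 0), ?_⟩
    have e1 : -x 1 * x 0 + x 0 * x 1 = 0 := by ring
    have e2 : -x 1 * y 0 + x 0 * y 1 = wedge x y := by unfold wedge; ring
    change ‖-x 1 * x 0 + x 0 * x 1‖ < ‖-x 1 * y 0 + x 0 * y 1‖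
    rw [e1, e2, norm_zero]
    exact norm_pos_iff.mpr h
  obtain ⟨⟨r, s⟩, hrs⟩ :=
    ((Padic.denseRange_ratCast p).prodMap (Padic.denseRange_ratCast p)).exists_mem_open hopen hne
  change ‖(r : ℚ_[p]) * x 0 + (s : ℚ_[p]) * x 1‖ < ‖(r : ℚ_[p]) * y 0 + (s : ℚ_[p]) * y 1‖ at hrs
  have hY : (r : ℚ_[p]) * y 0 + (s : ℚ_[p]) * y 1 ≠ 0 := fun h0 => by
    rw [h0, norm_zero] at hrs
    exact absurd hrs (not_lt.mpr (norm_nonneg _))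
  set X := (r : ℚ_[p]) * x 0 + (s : ℚ_[p]) * x 1 with hX
  set Y := (r : ℚ_[p]) * y 0 + (s : ℚ_[p]) * y 1 with hYdef
  have hle : ‖-(X / Y)‖ ≤ 1 := by
    rw [norm_neg, norm_div]
    exact div_le_one_of_le₀ hrs.le (norm_nonneg _)
  have hr : ((r.num : ℤ) : ℚ_[p]) = r * (r.den : ℚ_[p]) := by
    have := Rat.mul_den_eq_num r
    exact_mod_cast (congrArg (Rat.cast : ℚ → ℚ_[p]) this).symm
  have hs : ((s.num : ℤ) : ℚ_[p]) = s * (s.den : ℚ_[p]) := by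
    have := Rat.mul_den_eq_num s
    exact_mod_cast (congrArg (Rat.cast : ℚ → ℚ_[p]) this).symm
  refine ⟨⟨-(X / Y), hle⟩, r.num * s.den, s.num * r.den, ?_, ?_⟩
  · intro h0
    have h1 : r.num = 0 := by simpa using congrArg Prod.fst h0
    have h2 : s.num = 0 := by simpa using congrArg Prod.snd h0
    apply hY
    rw [hYdef, Rat.num_eq_zero.mp h1, Rat.num_eq_zero.mp h2]
    simp
  · change ((r.num * s.den : ℤ) : ℚ_[p]) * (x 0 + -(X / Y) * y 0) +
      ((s.num * r.den : ℤ) : ℚ_[p]) * (x 1 + -(X / Y) * y 1) = 0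
    push_cast
    rw [hr, hs]
    have e : X / Y * Y = X := div_mul_cancel₀ _ hY
    rw [hYdef] at e
    linear_combination (-(r.den : ℚ_[p]) * s.den) * e + (-(r.den : ℚ_[p]) * s.den) * (-hX)

/-- A power of a matrix of determinant `±1` over `ℤ_p` is congruent to `1` modulo `p²`. -/
theorem exists_pow_sub_one_norm_le {A : Matrix (Fin 2) (Fin 2) ℤ_[p]} (hA : A ∈ SLpm p) :
    ∃ K : ℕ, K ≠ 0 ∧ ∀ i j, ‖(A ^ K - 1) i j‖ ≤ ((p : ℝ) ^ 2)⁻¹ := by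
  have : NeZero (p ^ 2) := ⟨pow_ne_zero 2 hp.out.ne_zero⟩
  let f := (PadicInt.toZModPow (p := p) 2).mapMatrix (m := Fin 2)
  have hu : IsUnit A := by
    rw [Matrix.isUnit_iff_isUnit_det]
    rcases hA with h | h <;> rw [h]
    · exact isUnit_one
    · exact isUnit_one.neg
  obtain ⟨u, hu⟩ := hu.map f
  refine ⟨orderOf u, (orderOf_pos u).ne', fun i j => ?_⟩
  have h1 : f (A ^ orderOf u - 1) = 0 := by
    rw [map_sub, map_pow, map_one, ← hu, ← Units.val_pow_eq_pow_val, pow_orderOf_eq_one,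
      Units.val_one, sub_self]
  have h2 : PadicInt.toZModPow 2 ((A ^ orderOf u - 1) i j) = 0 := congrFun (congrFun h1 i) j
  rw [← RingHom.mem_ker, PadicInt.ker_toZModPow, ← PadicInt.norm_le_pow_iff_mem_span_pow] at h2
  simpa [zpow_neg] using h2

/-! ### Eigenvectors -/

theorem exists_eq_smul_of_wedge_eq_zero {F : Type*} [Field F] {r s : Fin 2 → F} (hr : r ≠ 0)
    (h : wedge r s = 0) : ∃ l : F, s = l • r := by
  unfold wedge at h
  by_cases h0 : r 0 = 0
  · have h1 : r 1 ≠ 0 := fun h1 => hr (by ext i; fin_cases i <;> simp [h0, h1])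
    refine ⟨s 1 / r 1, ?_⟩
    ext i
    fin_cases i
    · have : s 0 = 0 := by
        rw [h0, zero_mul, zero_sub, neg_eq_zero] at h
        exact (mul_eq_zero.mp h).resolve_left h1
      simp [this, h0]
    · simp [h1]
  · refine ⟨s 0 / r 0, ?_⟩
    ext i
    fin_cases i
    · simp [h0]
    · simp only [Fin.mk_one, Pi.smul_apply, smul_eq_mul]
      field_simp
      linear_combination h

/-- The matrix `A` viewed over `ℚ_p`. -/
def toQp (A : Matrix (Fin 2) (Fin 2) ℤ_[p]) : Matrix (Fin 2) (Fin 2) ℚ_[p] :=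
  PadicInt.Coe.ringHom.mapMatrix A

theorem toQp_apply (A : Matrix (Fin 2) (Fin 2) ℤ_[p]) (i j : Fin 2) :
    toQp A i j = (A i j : ℚ_[p]) := rfl

/-- A vector that spans a line fixed by `Aᵀ` yields an eigenvector of `A`. -/
theorem exists_eigenpoint_of_wedge_transpose_eq_zero {v : Fin 2 → ℚ_[p]} (hv : v ≠ 0) :
    ∃ P : Projectivization (PadicAlgCl p) (Fin 2 → PadicAlgCl p),
      ∀ A : Matrix (Fin 2) (Fin 2) ℤ_[p], wedge v ((toQp A).transpose.mulVec v) = 0 →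
        P ∈ eigenpoints A := by
  -- The right-angle turn conjugates the transpose of `A` into the adjugate `trace A - A`, which has
  -- the same eigenvectors as `A`. The point depends on `v` alone, so it serves all `A` at once.
  let r : Fin 2 → ℚ_[p] := ![-v 1, v 0]
  have hr : r ≠ 0 := by
    intro h
    apply hv
    have h0 : -v 1 = 0 := congrFun h 0
    have h1 : v 0 = 0 := congrFun h 1
    ext i
    fin_cases i
    · exact h1
    · exact neg_eq_zero.mp h0
  let f := algebraMap ℚ_[p] (PadicAlgCl p)
  let s : Fin 2 → PadicAlgCl p := fun i => f (r i)
  have hs : s ≠ 0 := by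
    intro h
    apply hr
    ext i
    exact (map_eq_zero f).mp (congrFun h i)
  refine ⟨Projectivization.mk _ s hs, fun A hA => ?_⟩
  have hw : wedge r ((toQp A).mulVec r) = 0 := by
    rw [← neg_eq_zero, ← hA]
    simp only [wedge, Matrix.mulVec, dotProduct, Fin.sum_univ_two, r, Matrix.cons_val_zero,
      Matrix.cons_val_one, Matrix.transpose_apply]
    ring
  obtain ⟨l, hl⟩ := exists_eq_smul_of_wedge_eq_zero hr hw
  have hls : endAlgCl A s = f l • s := by
    ext i
    have := congrArg f (congrFun hl i)
    simp only [Matrix.mulVec, dotProduct, map_sum, map_mul, Pi.smul_apply, smul_eq_mul] at this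
    simp only [endAlgCl, Matrix.toLin'_apply, Matrix.mulVec, dotProduct, Pi.smul_apply,
      smul_eq_mul]
    exact this
  obtain ⟨c, hc⟩ := Projectivization.exists_smul_eq_mk_rep (PadicAlgCl p) s hs
  refine ⟨f l, Module.End.hasEigenvector_iff.mpr
    ⟨Module.End.mem_eigenspace_iff.mpr ?_, Projectivization.rep_nonzero _⟩⟩
  rw [← hc, Units.smul_def, map_smul, hls, smul_comm]

/-- The powers of a `2 × 2` matrix are linear polynomials in the matrix. -/
theorem exists_pow_eq_smul_add_smul {R : Type*} [CommRing R] (A : Matrix (Fin 2) (Fin 2) R)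
    (K : ℕ) : ∃ α β : R, A ^ K = α • A + β • (1 : Matrix (Fin 2) (Fin 2) R) := by
  induction K with
  | zero => exact ⟨0, 1, by simp⟩
  | succ K ih =>
    obtain ⟨α, β, h⟩ := ih
    refine ⟨α * A.trace + β, -(α * A.det), ?_⟩
    have hsq : A * A = A.trace • A - A.det • (1 : Matrix (Fin 2) (Fin 2) R) := by
      ext i j
      fin_cases i <;> fin_cases j <;>
        simp [Matrix.mul_apply, Fin.sum_univ_two, Matrix.trace_fin_two, Matrix.det_fin_two] <;> ring
    rw [pow_succ, h, add_mul, smul_mul_assoc, smul_mul_assoc, one_mul, hsq, smul_sub, smul_smul,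
      smul_smul, add_smul, neg_smul]
    abel

theorem norm_pow_kappa_sub_one_le (A : Matrix (Fin 2) (Fin 2) ℤ_[p]) {l : PadicAlgCl p}
    (hl : (endAlgCl A).HasEigenvalue l) : ‖l ^ kappa A - 1‖ ≤ (p : ℝ)⁻¹ := by
  by_cases h : {k : ℕ | 0 < k ∧ k ≤ p ^ 2 ∧
    ∀ l : PadicAlgCl p, (endAlgCl A).HasEigenvalue l → ‖l ^ k - 1‖ ≤ (p : ℝ)⁻¹}.Nonempty
  · exact (Nat.sInf_mem h).2.2 l hl
  -- If no exponent is admissible, `sInf ∅ = 0` and the bound is trivial.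
  · have : kappa A = 0 := by
      rw [kappa, Set.not_nonempty_iff_eq_empty.mp h, Nat.sInf_empty]
    rw [this, pow_zero, sub_self, norm_zero]
    positivity

/-- No positive power of a matrix in `SLtilde` is a scalar matrix. -/
theorem pow_ne_smul_one_of_mem_SLtilde {A : Matrix (Fin 2) (Fin 2) ℤ_[p]} (hA : A ∈ SLtilde p)
    {K : ℕ} (hK : K ≠ 0) (β : ℤ_[p]) : A ^ K ≠ β • (1 : Matrix (Fin 2) (Fin 2) ℤ_[p]) := by
  intro h
  obtain ⟨P, ⟨l, hl⟩⟩ := hA.1.2.nonempty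
  have hlv := Module.End.hasEigenvalue_of_hasEigenvector hl
  refine hA.2 l hlv (padicLog_eq_zero_of_pow_eq_one (K := K * 4)
    (norm_pow_kappa_sub_one_le A hlv) (by omega) ?_)
  -- Determinants give `β ^ 2 = ±1`; this is the source of the exponent `K * 4`.
  have hβ4 : β ^ 4 = 1 := by
    have hd := congrArg Matrix.det h
    rw [Matrix.det_pow, Matrix.det_smul, Matrix.det_one, mul_one, Fintype.card_fin] at hd
    have hd2 : (A.det ^ K) ^ 2 = 1 := by
      rcases hA.1.1 with h1 | h1 <;> rw [h1]
      · simp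
      · rw [← pow_mul, mul_comm, pow_mul]; simp
    rw [hd] at hd2
    rw [← hd2]; ring
  have hpow : endAlgCl A ^ K = toAlgCl p β • (1 : Module.End (PadicAlgCl p) _) := by
    have hm : (A.map (toAlgCl p)) ^ K = toAlgCl p β • (1 : Matrix (Fin 2) (Fin 2) (PadicAlgCl p)) := by
      have := congrArg (toAlgCl p).mapMatrix h
      rw [map_pow] at this
      refine this.trans ?_
      ext i j
      simp [Matrix.one_apply, apply_ite (toAlgCl p)]
    rw [endAlgCl, ← Matrix.toLin'_pow, hm, map_smul, Matrix.toLin'_one]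
    rfl
  have hlK : l ^ K = toAlgCl p β := by
    have h1 := hl.pow_apply K
    rw [hpow] at h1
    exact (smul_left_injective _ hl.2 h1).symm
  rw [← pow_mul, mul_comm, pow_mul, pow_mul, hlK, ← map_pow, hβ4, map_one, one_pow]

/-! ### Vectors whose orbit stays badly approximable -/

variable (p) in
/-- The vectors that satisfy the inequalities which define `PBadEps`. -/
def badVectors (ε : ℝ) : Set (Fin 2 → ℚ_[p]) :=
  {v | ∀ a b : ℤ, (a, b) ≠ (0, 0) →
    ε * max ‖v 0‖ ‖v 1‖ ≤
      ‖(a : ℚ_[p]) * v 0 + (b : ℚ_[p]) * v 1‖ * max |(a : ℝ)| |(b : ℝ)| ^ 2}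

theorem isClosed_badVectors (ε : ℝ) : IsClosed (badVectors p ε) := by
  simp only [badVectors, Set.ofPred_forall]
  refine isClosed_iInter fun a => isClosed_iInter fun b => isClosed_iInter fun _ => ?_
  exact isClosed_le (by fun_prop) (by fun_prop)

theorem smul_mem_badVectors {ε : ℝ} (c : ℚ_[p]) {v : Fin 2 → ℚ_[p]} (hv : v ∈ badVectors p ε) :
    c • v ∈ badVectors p ε := by
  intro a b hab
  have e : (a : ℚ_[p]) * (c • v) 0 + (b : ℚ_[p]) * (c • v) 1 =
      c * ((a : ℚ_[p]) * v 0 + (b : ℚ_[p]) * v 1) := by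
    simp only [Pi.smul_apply, smul_eq_mul]; ring
  have e' : max ‖(c • v) 0‖ ‖(c • v) 1‖ = ‖c‖ * max ‖v 0‖ ‖v 1‖ := by
    simp only [Pi.smul_apply, smul_eq_mul, norm_mul]
    exact (mul_max_of_nonneg _ _ (norm_nonneg c)).symm
  rw [e, e', norm_mul, mul_left_comm, mul_assoc]
  exact mul_le_mul_of_nonneg_left (hv a b hab) (norm_nonneg c)

variable (p) in
/-- The matrix of the prefix of length `n`, over `ℚ_p`. -/
def prefixMatrix (w : Word) (n : ℕ) : Matrix (Fin 2) (Fin 2) ℚ_[p] :=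
  (Int.castRingHom ℚ_[p]).mapMatrix (wordMatrix (wordPrefix w n))

theorem wordPrefix_add (w : Word) (m n : ℕ) :
    wordPrefix w (m + n) = wordPrefix w m ++ wordPrefix (shift^[m] w) n := by
  have hs : ∀ i, shift^[m] w i = w (m + i) := by
    intro i
    induction m generalizing w with
    | zero => simp
    | succ m ih =>
      rw [Function.iterate_succ_apply, ih]
      exact congrArg w (by omega)
  simp [wordPrefix, List.range_add, Function.comp_def, hs]

theorem wordMatrix_append (u v : List ℕ+) : wordMatrix (u ++ v) = wordMatrix u * wordMatrix v := by
  simp [wordMatrix]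

theorem prefixMatrix_zero (w : Word) : prefixMatrix p w 0 = 1 := by
  simp [prefixMatrix, wordPrefix, wordMatrix]

theorem prefixMatrix_add (w : Word) (m n : ℕ) :
    prefixMatrix p w (m + n) = prefixMatrix p w m * prefixMatrix p (shift^[m] w) n := by
  rw [prefixMatrix, wordPrefix_add, wordMatrix_append, map_mul]
  rfl

theorem prefixMatrix_one (w : Word) :
    prefixMatrix p w 1 = (letterMatrix (w 0)).map (Int.cast : ℤ → ℚ_[p]) := by
  simp [prefixMatrix, wordPrefix, wordMatrix]

theorem transpose_prefixMatrix_one (w : Word) :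
    (prefixMatrix p w 1).transpose = prefixMatrix p w 1 := by
  rw [prefixMatrix_one]
  ext i j
  fin_cases i <;> fin_cases j <;> rfl

/-- A new letter multiplies the prefix matrix on the right but acts on the point from the left; the
symmetry of letter matrices reconciles the two through the transpose. -/
theorem extShift_iterate (w : Word) (v : Fin 2 → ℚ_[p]) (hv : v ≠ 0) (n : ℕ) :
    ∃ h : (prefixMatrix p w n).transpose.mulVec v ≠ 0,
      (extShift p)^[n] (w, Projectivization.mk ℚ_[p] v hv) =
        (shift^[n] w, Projectivization.mk ℚ_[p] _ h) := by
  induction n with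
  | zero =>
    have e : (prefixMatrix p w 0).transpose.mulVec v = v := by simp [prefixMatrix_zero]
    refine ⟨by rwa [e], ?_⟩
    simp only [Function.iterate_zero, id_eq, e]
  | succ n ih =>
    obtain ⟨h, ih⟩ := ih
    have e : letterMap p ((shift^[n] w) 0) ((prefixMatrix p w n).transpose.mulVec v) =
        (prefixMatrix p w (n + 1)).transpose.mulVec v := by
      rw [prefixMatrix_add, Matrix.transpose_mul, transpose_prefixMatrix_one, prefixMatrix_one,
        ← Matrix.mulVec_mulVec]
      rfl
    have hne : (prefixMatrix p w (n + 1)).transpose.mulVec v ≠ 0 := by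
      rw [← e]
      exact (map_ne_zero_iff _ (letterMap_injective p _)).mpr h
    refine ⟨hne, ?_⟩
    rw [Function.iterate_succ_apply', ih, Function.iterate_succ_apply']
    simp only [extShift, Projectivization.map_mk, e]

variable (p) in
/-- The vectors that give rise to a pair in `LMadEps` with first member `w`. -/
def badOrbitVectors (w : Word) (ε : ℝ) : Set (Fin 2 → ℚ_[p]) :=
  {v | ∀ n : ℕ, 1 ≤ n → (prefixMatrix p w n).transpose.mulVec v ∈ badVectors p ε}

theorem mem_badOrbitVectors {w : Word} {ε : ℝ} {v : Fin 2 → ℚ_[p]} {hv : v ≠ 0}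
    (h : (w, Projectivization.mk ℚ_[p] v hv) ∈ LMadEps p ε) : v ∈ badOrbitVectors p w ε := by
  intro n hn
  obtain ⟨hne, he⟩ := extShift_iterate w v hv n
  have h2 := (h n hn).2
  rw [he] at h2
  exact (mk_mem_PBadEps_iff p ε _ hne).mp h2

theorem transpose_mulVec_mem_badOrbitVectors {w : Word} {ε : ℝ}
    {A : Matrix (Fin 2) (Fin 2) ℤ_[p]} (hA : A ∈ Vp p w) {v : Fin 2 → ℚ_[p]}
    (hv : v ∈ badOrbitVectors p w ε) :
    (toQp A).transpose.mulVec v ∈ badOrbitVectors p w ε := by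
  intro n hn
  have hcont : Continuous fun A : Matrix (Fin 2) (Fin 2) ℤ_[p] =>
      (prefixMatrix p w n).transpose.mulVec ((toQp A).transpose.mulVec v) := by
    have h1 : Continuous fun A : Matrix (Fin 2) (Fin 2) ℤ_[p] => toQp A :=
      continuous_id.matrix_map continuous_subtype_val
    exact continuous_const.matrix_mulVec (h1.matrix_transpose.matrix_mulVec continuous_const)
  have hsub : Vpn p n w ⊆ {A | (prefixMatrix p w n).transpose.mulVec
      ((toQp A).transpose.mulVec v) ∈ badVectors p ε} := by
    rintro B ⟨m, hm, rfl⟩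
    have e1 : toQp ((wordMatrix (wordPrefix w m)).map (Int.cast : ℤ → ℤ_[p])) =
        prefixMatrix p w m := by
      ext i j
      simp [toQp_apply, prefixMatrix]
    have e2 : prefixMatrix p (shift^[m] w) n = prefixMatrix p w n := by
      rw [prefixMatrix, hm, prefixMatrix]
    change (prefixMatrix p w n).transpose.mulVec (_ : Fin 2 → ℚ_[p]) ∈ badVectors p ε
    rw [e1, Matrix.mulVec_mulVec, ← Matrix.transpose_mul, ← e2, ← prefixMatrix_add]
    exact hv (m + n) (by omega)
  exact closure_minimal hsub ((isClosed_badVectors ε).preimage hcont)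
    (Set.mem_iInter₂.mp hA n hn)

theorem norm_det_toQp {A : Matrix (Fin 2) (Fin 2) ℤ_[p]} (hA : A ∈ SLpm p) :
    ‖(toQp A).det‖ = 1 := by
  rw [toQp, ← RingHom.map_det]
  rcases hA with h | h <;> rw [h] <;> simp

/-- A bad vector spans a line fixed by the transpose of every matrix in `SLtilde ∩ Vp w`. -/
theorem wedge_transpose_mulVec_eq_zero {w : Word} {ε : ℝ} (hε : 0 < ε)
    {A : Matrix (Fin 2) (Fin 2) ℤ_[p]} (hA : A ∈ SLtilde p) (hV : A ∈ Vp p w)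
    {v : Fin 2 → ℚ_[p]} (hv : v ∈ badOrbitVectors p w ε) :
    wedge v ((toQp A).transpose.mulVec v) = 0 := by
  by_contra hne
  obtain ⟨K, hK, hnorm⟩ := exists_pow_sub_one_norm_le hA.1.1
  set E : Matrix (Fin 2) (Fin 2) ℚ_[p] := (toQp (A ^ K - 1)).transpose with hEdef
  have hE : ∀ i j, ‖E i j‖ ≤ ((p : ℝ) ^ 2)⁻¹ := fun i j => hnorm j i
  have hpow : 1 + E = (toQp A).transpose ^ K := by
    rw [hEdef, toQp, map_sub, map_pow, map_one, Matrix.transpose_sub, Matrix.transpose_one,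
      add_sub_cancel, Matrix.transpose_pow, toQp]
  have hdet : ‖(1 + E).det‖ = 1 := by
    rw [hpow, Matrix.det_pow, Matrix.det_transpose, norm_pow, norm_det_toQp hA.1.1, one_pow]
  have hx : wedge v (E.mulVec v) ≠ 0 := by
    obtain ⟨α, β, hαβ⟩ := exists_pow_eq_smul_add_smul A K
    -- With `α = 0` the power `A ^ K` would be scalar. As `α ≠ 0`, the power moves the line of `v`
    -- whenever `A` does.
    have hα : α ≠ 0 := by
      rintro rfl
      rw [zero_smul, zero_add] at hαβ
      exact pow_ne_smul_one_of_mem_SLtilde hA hK β hαβ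
    have e : E = (α : ℚ_[p]) • (toQp A).transpose +
        ((β : ℚ_[p]) - 1) • (1 : Matrix (Fin 2) (Fin 2) ℚ_[p]) := by
      rw [hEdef, hαβ]
      ext i j
      fin_cases i <;> fin_cases j <;> simp [toQp_apply] <;> ring
    have e2 : wedge v (E.mulVec v) = (α : ℚ_[p]) * wedge v ((toQp A).transpose.mulVec v) := by
      rw [e, Matrix.add_mulVec, Matrix.smul_mulVec, Matrix.smul_mulVec, Matrix.one_mulVec]
      simp only [wedge, Pi.add_apply, Pi.smul_apply, smul_eq_mul]
      ring
    rw [e2]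
    exact mul_ne_zero (fun h => hα (Subtype.coe_injective h)) hne
  have horb : ∀ k : ℕ, ((1 + E) ^ k).mulVec v ∈ badOrbitVectors p w ε := by
    intro k
    rw [hpow, ← pow_mul]
    generalize K * k = n
    induction n with
    | zero => simpa using hv
    | succ n ih =>
      rw [pow_succ', ← Matrix.mulVec_mulVec]
      exact transpose_mulVec_mem_badOrbitVectors hV ih
  -- Badness is required only from the first iterate on, so the orbit is tested after applying one
  -- letter.
  set L : Matrix (Fin 2) (Fin 2) ℚ_[p] := prefixMatrix p w 1 with hL
  have hmem : ∀ t : ℤ_[p], L.mulVec (v + (t : ℚ_[p]) • E.mulVec v) ∈ badVectors p ε := by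
    refine add_smul_mem_of_orbit_mem hE hdet hx (C := {u | L.mulVec u ∈ badVectors p ε}) ?_ ?_ ?_
    · exact (isClosed_badVectors ε).preimage
        (continuous_const.matrix_mulVec continuous_id)
    · intro c u hu
      change L.mulVec (c • u) ∈ badVectors p ε
      rw [Matrix.mulVec_smul]
      exact smul_mem_badVectors c hu
    · intro k
      have := horb k 1 le_rfl
      rwa [transpose_prefixMatrix_one] at this
  obtain ⟨t, c, d, hcd, ht⟩ := exists_int_relation hx
  set u := v + (t : ℚ_[p]) • E.mulVec v with hu
  have hu0 : u ≠ 0 := by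
    intro h
    apply hx
    have h0 := congrFun h 0
    have h1 := congrFun h 1
    simp only [hu, Pi.add_apply, Pi.smul_apply, smul_eq_mul, Pi.zero_apply] at h0 h1
    unfold wedge
    linear_combination (E.mulVec v 1) * h0 - (E.mulVec v 0) * h1
  have hL0 : L.mulVec u 0 = u 1 := by
    simp [hL, prefixMatrix_one, letterMatrix, Matrix.mulVec, dotProduct, Fin.sum_univ_two]
  have hL1 : L.mulVec u 1 = u 0 + (((w 0 : ℕ) : ℤ) : ℚ_[p]) * u 1 := by
    simp [hL, prefixMatrix_one, letterMatrix, Matrix.mulVec, dotProduct, Fin.sum_univ_two]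
  -- The relation `c u₀ + d u₁ = 0` rewritten in the coordinates `(u₁, u₀ + a u₁)` of `L u`, with
  -- `a` the first letter.
  have hab : (d - c * ((w 0 : ℕ) : ℤ), c) ≠ ((0 : ℤ), (0 : ℤ)) := by
    intro h
    have hc : c = 0 := congrArg Prod.snd h
    have hd : d - c * ((w 0 : ℕ) : ℤ) = 0 := congrArg Prod.fst h
    rw [hc, zero_mul, sub_zero] at hd
    exact hcd (by rw [hc, hd])
  have hineq := hmem t (d - c * ((w 0 : ℕ) : ℤ)) c hab
  have hzero : ((d - c * ((w 0 : ℕ) : ℤ) : ℤ) : ℚ_[p]) * L.mulVec u 0 +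
      (c : ℚ_[p]) * L.mulVec u 1 = 0 := by
    rw [hL0, hL1, ← ht]
    push_cast
    ring
  rw [← hu, hzero, norm_zero, zero_mul] at hineq
  have hmax : max ‖L.mulVec u 0‖ ‖L.mulVec u 1‖ ≤ 0 := by
    by_contra h
    exact absurd hineq (not_le.mpr (mul_pos hε (not_le.mp h)))
  have h0 : u 1 = 0 := by
    rw [← hL0]
    exact norm_le_zero_iff.mp ((le_max_left _ _).trans hmax)
  have h1 : u 0 = 0 := by
    have := norm_le_zero_iff.mp ((le_max_right _ _).trans hmax)
    rwa [hL1, h0, mul_zero, add_zero] at this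
  apply hu0
  ext i
  fin_cases i
  · exact h1
  · exact h0

end

end PLC

theorem corollary6p2 (p : ℕ) [Fact p.Prime] (N : ℕ) (w : PLC.Word) (hw : w ∈ PLC.words N)
    (A₁ A₂ : Matrix (Fin 2) (Fin 2) ℤ_[p])
    (hA₁ : A₁ ∈ PLC.SLtilde p) (hA₂ : A₂ ∈ PLC.SLtilde p)
    (hdisj : Disjoint (PLC.eigenpoints A₁) (PLC.eigenpoints A₂))
    (hV₁ : A₁ ∈ PLC.Vp p w) (hV₂ : A₂ ∈ PLC.Vp p w)
    (xp : PLC.ProjLine p) :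
    (w, xp) ∉ PLC.LMad p := by
  rintro ⟨ε, hε, hmem⟩
  induction xp using Projectivization.ind with
  | h v hv =>
    have hbad := PLC.mem_badOrbitVectors hmem
    obtain ⟨P, hP⟩ := PLC.exists_eigenpoint_of_wedge_transpose_eq_zero hv
    exact Set.disjoint_left.mp hdisj
      (hP A₁ (PLC.wedge_transpose_mulVec_eq_zero hε hA₁ hV₁ hbad))
      (hP A₂ (PLC.wedge_transpose_mulVec_eq_zero hε hA₂ hV₂ hbad))
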